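/- Let $c$ denote the cardinality of the continuum. For each integer $n\ge 2$ there is a family $\mathcal F_n$ of open subsets of the Euclidean space $\mathbb R^n$ such that $\mathcal F_n$ has cardinality $c$ and, whenever $U,V\in\mathcal F_n$ and $U\ne V$, the subspaces $U$ and $V$ of $\mathbb R^n$ are not homeomorphic and their closures $\overline U$ and $\overline V$ in $\mathbb R^n$ are not homeomorphic. Moreover, the family $\mathcal F_n$ can be chosen so that for every $X\in\mathcal F_n$ the closure $\overline X$ is compact and is a union of closed cubes of the form $[a_1,a_1+h]\times\cdots\times[a_n,a_n+h]$ with $h>0$ (where $h$ may vary from cube to cube) such that the interiors of distinct cubes are disjoint. Alternatively, the family $\mathcal F_n$ can be chosen so that for every $X\in\mathcal F_n$ the closure $\overline X$ is a union of unit cubes $[k_1,k_1+1]\times\cdots\times[k_n,k_n+1]$ with $k_1,\dots,k_n\in\mathbb Z$. -/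

import Mathlib

/-- The closed axis-parallel cube `[a₁, a₁ + h] × ⋯ × [aₙ, aₙ + h]` in `ℝⁿ`. -/
def closedCube {n : ℕ} (a : Fin n → ℝ) (h : ℝ) : Set (EuclideanSpace ℝ (Fin n)) :=
  {x | ∀ i, x i ∈ Set.Icc (a i) (a i + h)}

/-- `F` is a family of continuum many open subsets of `ℝⁿ` such that, for distinct members `U`
and `V`, neither the subspaces `U` and `V` nor their closures in `ℝⁿ` are homeomorphic. -/
structure IsDistinctOpenFamily {n : ℕ} (F : Set (Set (EuclideanSpace ℝ (Fin n)))) : Prop where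
  isOpen : ∀ U ∈ F, IsOpen U
  card_eq : Cardinal.mk F = Cardinal.continuum
  not_homeomorphic : ∀ U ∈ F, ∀ V ∈ F, U ≠ V → ¬ Nonempty (U ≃ₜ V)
  closure_not_homeomorphic : ∀ U ∈ F, ∀ V ∈ F, U ≠ V → ¬ Nonempty (closure U ≃ₜ closure V)

/-- `A` is a union of closed cubes with positive edge lengths (which may vary from cube to cube),
where the interiors of distinct cubes are disjoint. -/
def IsUnionOfNonoverlappingCubes {n : ℕ} (A : Set (EuclideanSpace ℝ (Fin n))) : Prop :=
  ∃ Q : Set (Set (EuclideanSpace ℝ (Fin n))),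
    (∀ C ∈ Q, ∃ (a : Fin n → ℝ) (h : ℝ), 0 < h ∧ C = closedCube a h) ∧
    (∀ C ∈ Q, ∀ C' ∈ Q, C ≠ C' → Disjoint (interior C) (interior C')) ∧
    A = ⋃₀ Q

/-- `A` is a union of unit cubes `[k₁, k₁ + 1] × ⋯ × [kₙ, kₙ + 1]` with integers `kᵢ`. -/
def IsUnionOfIntegerUnitCubes {n : ℕ} (A : Set (EuclideanSpace ℝ (Fin n))) : Prop :=
  ∃ K : Set (Fin n → ℤ), A = ⋃ k ∈ K, closedCube (fun i => (k i : ℝ)) 1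

/-! Each `S ⊆ ℕ` is coded by an open set from which `S` can be read back topologically, which yields
`2 ^ ℵ₀` sets. Closed cubes are placed along the diagonal of `ℝⁿ`, neighbours meeting in a single
corner, and for each `k ∈ S` a chain of `k + 2` of them is kept, distinct chains being separated by
gaps. The open set consists of the interiors of these cubes, with `k + 1` points deleted from every
cube of chain `k`, and of one unpunctured open unit cube.

Its components are single cubes. Those of chain `k` are homeomorphic to `ℝⁿ` minus `k + 1` points,
which for `n ≥ 2` has `k + 2` ends, so `k` is an invariant (`ncard_eq_of_homeomorph_compl`). Closing
up fills the punctures and glues the cubes at corners: the components become whole chains, and chain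
`k` has exactly `k + 1` cut points, its shared corners (`cutPoints_cubeChain`). The extra cube has
neither punctures nor cut points, so it is never mistaken for a chain.

Only the corner sequence `t` differs between the two versions. Integer corners give unit cubes.
Corners increasing to `0` give a bounded set; the chains can accumulate only at the origin, which is
a corner of the extra cube `[0, 1]ⁿ`, so the union is compact. -/

open Set Metric

/-! ### Components and cut points under homeomorphisms -/

section Topology

variable {X : Type*} [TopologicalSpace X] {A B : Set X}

/-- A homeomorphism between subspaces restricts to homeomorphisms between their components. -/
theorem exists_homeomorph_connectedComponentIn (h : A ≃ₜ B) {x : X} (hx : x ∈ A) :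
    ∃ y ∈ B, Nonempty (connectedComponentIn A x ≃ₜ connectedComponentIn B y) := by
  refine ⟨h ⟨x, hx⟩, (h ⟨x, hx⟩).2, ⟨?_⟩⟩
  have h1 : connectedComponentIn A x = (↑) '' connectedComponent (⟨x, hx⟩ : A) :=
    connectedComponentIn_eq_image hx
  have h2 : connectedComponentIn B (h ⟨x, hx⟩) = (↑) '' connectedComponent (h ⟨x, hx⟩) :=
    connectedComponentIn_eq_image (h ⟨x, hx⟩).2
  have h3 : h '' connectedComponent ⟨x, hx⟩ = connectedComponent (h ⟨x, hx⟩) := by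
    have := h.image_connectedComponentIn (mem_univ (⟨x, hx⟩ : A))
    simpa [connectedComponentIn_univ] using this
  refine (Homeomorph.setCongr h1).trans (Homeomorph.trans ?_ (Homeomorph.setCongr h2).symm)
  exact ((Topology.IsEmbedding.subtypeVal.homeomorphImage _).symm.trans
    ((h.image _).trans (Homeomorph.setCongr h3))).trans
    (Topology.IsEmbedding.subtypeVal.homeomorphImage _)

/-- A homeomorphism invariant labelling of components determines the set of labels. -/
theorem eq_of_homeomorph_of_component_label {P : ℕ → Set X → Prop}
    (hP : ∀ k (C D : Set X), Nonempty (C ≃ₜ D) → P k C → P k D) {S T : Set ℕ}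
    (hA : ∀ k, k ∈ S ↔ ∃ x ∈ A, P k (connectedComponentIn A x))
    (hB : ∀ k, k ∈ T ↔ ∃ x ∈ B, P k (connectedComponentIn B x)) (h : Nonempty (A ≃ₜ B)) :
    S = T := by
  obtain ⟨h⟩ := h
  ext k
  rw [hA, hB]
  constructor
  · rintro ⟨x, hx, hk⟩
    obtain ⟨y, hy, e⟩ := exists_homeomorph_connectedComponentIn h hx
    exact ⟨y, hy, hP k _ _ e hk⟩
  · rintro ⟨x, hx, hk⟩
    obtain ⟨y, hy, e⟩ := exists_homeomorph_connectedComponentIn h.symm hx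
    exact ⟨y, hy, hP k _ _ e hk⟩

/-- The sets `u` and `v` have to be disjoint only on `A`, so overlapping coordinate windows are
allowed. -/
theorem connectedComponentIn_eq_of_separated {C u v : Set X} (hC : IsPreconnected C)
    (hu : IsOpen u) (hv : IsOpen v) (huv : A ⊆ u ∪ v) (hd : ∀ x ∈ A, x ∈ u → x ∉ v)
    (hAu : A ∩ u = C) {x : X} (hx : x ∈ C) : connectedComponentIn A x = C := by
  have hCA : C ⊆ A := hAu ▸ inter_subset_left
  refine Subset.antisymm ?_ (hC.subset_connectedComponentIn hx hCA)
  intro y hy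
  have hyA := connectedComponentIn_subset A x hy
  refine hAu ▸ ⟨hyA, ?_⟩
  by_contra hyu
  have hyv : y ∈ v := (huv hyA).resolve_left hyu
  obtain ⟨z, hz, hzu, hzv⟩ := isPreconnected_connectedComponentIn u v hu hv
    ((connectedComponentIn_subset A x).trans huv)
    ⟨x, mem_connectedComponentIn (hCA hx), (hAu.symm ▸ hx : x ∈ A ∩ u).2⟩ ⟨y, hy, hyv⟩
  exact hd z (connectedComponentIn_subset A x hz) hzu hzv

/-- If all pieces but one are components, then so is the remaining one. -/
theorem connectedComponentIn_eq_of_forall_diff {C : Set X} (hC : IsPreconnected C) (hCA : C ⊆ A)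
    (h : ∀ y ∈ A, y ∉ C → Disjoint (connectedComponentIn A y) C) {x : X} (hx : x ∈ C) :
    connectedComponentIn A x = C := by
  refine Subset.antisymm (fun y hy => ?_) (hC.subset_connectedComponentIn hx hCA)
  by_contra hyC
  have hyA := connectedComponentIn_subset A x hy
  have := h y hyA hyC
  rw [← connectedComponentIn_eq hy] at this
  exact disjoint_left.1 this (mem_connectedComponentIn (hCA hx)) hx

/-- The points whose removal disconnects `A`. -/
def cutPoints (A : Set X) : Set X := {p ∈ A | ¬ IsPreconnected (A \ {p})}

theorem isPreconnected_diff_singleton_iff (p : A) :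
    IsPreconnected (A \ {(p : X)}) ↔ IsPreconnected ({p}ᶜ : Set A) := by
  rw [← Topology.IsInducing.subtypeVal.isPreconnected_image]
  congr! 1
  ext x
  simp only [mem_sdiff, mem_singleton_iff, mem_image, mem_compl_iff, Subtype.exists,
    exists_and_right, exists_eq_right, Subtype.ext_iff]
  tauto

theorem Homeomorph.isPreconnected_diff_singleton_iff (h : A ≃ₜ B) (p : A) :
    IsPreconnected (B \ {(h p : X)}) ↔ IsPreconnected (A \ {(p : X)}) := by
  rw [_root_.isPreconnected_diff_singleton_iff, _root_.isPreconnected_diff_singleton_iff,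
    ← h.isPreconnected_image, image_compl_eq h.bijective, image_singleton]

theorem Homeomorph.ncard_cutPoints_eq (h : A ≃ₜ B) :
    (cutPoints A).ncard = (cutPoints B).ncard := by
  refine Set.ncard_congr (fun a ha => (h ⟨a, ha.1⟩ : X)) ?_ ?_ ?_
  · intro a ha
    exact ⟨(h _).2, fun hc => ha.2 ((h.isPreconnected_diff_singleton_iff ⟨a, ha.1⟩).1 hc)⟩
  · intro a b ha hb hab
    simpa using h.injective (Subtype.ext hab)
  · intro b hb
    refine ⟨h.symm ⟨b, hb.1⟩, ⟨(h.symm _).2, fun hc => hb.2 ?_⟩, by simp⟩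
    exact (h.symm.isPreconnected_diff_singleton_iff ⟨b, hb.1⟩).1 hc

end Topology

/-! ### Counting ends -/

section Ends

variable {Y Z J J' : Type*} [TopologicalSpace Y] [TopologicalSpace Z]

/-- Disjoint open sets that are not relatively compact and whose union has compact complement:
they separate the ends of the space into nonempty classes. -/
structure IsEndPartition (W : J → Set Y) : Prop where
  isOpen : ∀ j, IsOpen (W j)
  disjoint : Pairwise (Function.onFun Disjoint W)
  not_subset_compact : ∀ j K, IsCompact K → ¬ W j ⊆ K
  isCompact_compl : IsCompact (⋃ j, W j)ᶜ

theorem IsEndPartition.image {W : J → Set Y} (hW : IsEndPartition W) (h : Y ≃ₜ Z) :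
    IsEndPartition (fun j => h '' W j) where
  isOpen j := h.isOpenMap _ (hW.isOpen j)
  disjoint i j hij := (disjoint_image_iff h.injective).2 (hW.disjoint hij)
  not_subset_compact j K hK hjK := by
    refine hW.not_subset_compact j (h ⁻¹' K) (h.isCompact_preimage.2 hK) ?_
    exact image_subset_iff.1 hjK
  isCompact_compl := by
    rw [← image_iUnion, ← image_compl_eq h.bijective]
    exact hW.isCompact_compl.image h.continuous

/-- The number of classes is at most the number of connected neighbourhoods of ends. -/
theorem IsEndPartition.card_le [Finite J'] {W : J → Set Y} (hW : IsEndPartition W)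
    (hE : ∀ K : Set Y, IsCompact K → ∃ (N : J' → Set Y) (L : Set Y),
      (∀ i, IsPreconnected (N i)) ∧ (∀ i, Disjoint (N i) K) ∧ IsCompact L ∧ (⋃ i, N i)ᶜ ⊆ L) :
    Nat.card J ≤ Nat.card J' := by
  obtain ⟨N, L, hN, hNK, hL, hNL⟩ := hE _ hW.isCompact_compl
  have hmeet : ∀ j, ∃ i, (N i ∩ W j).Nonempty := by
    intro j
    by_contra! hcon
    refine hW.not_subset_compact j L hL (fun y hy => hNL ?_)
    simp only [compl_iUnion, mem_iInter, mem_compl_iff]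
    intro i hi
    exact (hcon i).subset ⟨hi, hy⟩
  choose f hf using hmeet
  refine Nat.card_le_card_of_injective f (fun j j' hjj => ?_)
  by_contra hne
  -- `N (f j)` avoids the compact remainder, so the `W i` cover it; being connected, it cannot meet
  -- both `W j` and `W j'`.
  have hsub : N (f j) ⊆ W j ∪ ⋃ i ∈ {i | i ≠ j}, W i := by
    intro y hy
    have : y ∈ ⋃ i, W i := by
      by_contra hy'
      exact disjoint_left.1 (hNK (f j)) hy hy'
    obtain ⟨i, hi⟩ := mem_iUnion.1 this
    by_cases hij : i = j
    · exact Or.inl (hij ▸ hi)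
    · exact Or.inr (mem_biUnion (show i ∈ {i | i ≠ j} from hij) hi)
  obtain ⟨y, -, hy, hy'⟩ := hN (f j) (W j) (⋃ i ∈ {i | i ≠ j}, W i) (hW.isOpen j)
    (isOpen_biUnion fun i _ => hW.isOpen i) hsub (hf j) (by
      obtain ⟨z, hz, hz'⟩ := hf j'
      rw [← hjj] at hz
      exact ⟨z, hz, mem_biUnion (show j' ∈ {i | i ≠ j} from Ne.symm hne) hz'⟩)
  simp only [mem_ofPred_eq, mem_iUnion, exists_prop] at hy'
  obtain ⟨i, hi, hyi⟩ := hy'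
  exact disjoint_left.1 (hW.disjoint (Ne.symm hi)) hy hyi

end Ends

/-! ### Punctured balls and punctured spaces -/

section NormedSpace

variable {E : Type*} [NormedAddCommGroup E] [NormedSpace ℝ E]

/-- The radial map that adds `R` to the norm carries the connected space `E \ {0}` onto this set. -/
theorem isPreconnected_compl_closedBall (hE : 1 < Module.rank ℝ E) {R : ℝ} (hR : 0 ≤ R) :
    IsPreconnected (closedBall (0 : E) R)ᶜ := by
  have hc : ContinuousOn (fun y : E => (1 + R * ‖y‖⁻¹) • y) {0}ᶜ := by
    intro y hy
    have : ‖y‖ ≠ 0 := by simpa using hy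
    apply ContinuousAt.continuousWithinAt
    fun_prop (disch := assumption)
  have := (isConnected_compl_singleton_of_one_lt_rank hE 0).isPreconnected.image _ hc
  convert this using 1
  ext z
  simp only [mem_compl_iff, mem_closedBall, dist_zero_right, not_le, mem_image, mem_singleton_iff]
  constructor
  · intro hz
    have hz0 : 0 < ‖z‖ := hR.trans_lt hz
    have hzR : ‖z‖ - R ≠ 0 := (sub_pos.2 hz).ne'
    have hnorm : ‖((‖z‖ - R) / ‖z‖) • z‖ = ‖z‖ - R := by
      rw [norm_smul, Real.norm_of_nonneg (div_nonneg (sub_nonneg.2 hz.le) hz0.le)]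
      field_simp
    refine ⟨((‖z‖ - R) / ‖z‖) • z, ?_, ?_⟩
    · intro h0
      rw [h0, norm_zero] at hnorm
      exact hzR hnorm.symm
    · rw [hnorm, smul_smul]
      have : (1 + R * (‖z‖ - R)⁻¹) * ((‖z‖ - R) / ‖z‖) = 1 := by
        field_simp
        ring
      rw [this, one_smul]
  · rintro ⟨y, hy, rfl⟩
    have hy0 : 0 < ‖y‖ := norm_pos_iff.2 hy
    rw [norm_smul, Real.norm_of_nonneg (by positivity), add_mul, mul_assoc,
      inv_mul_cancel₀ hy0.ne']
    linarith

/-- A ball without finitely many points is the whole space without equally many points. -/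
theorem exists_homeomorph_ball_diff {c : E} {r : ℝ} (hr : 0 < r) {P : Set E}
    (hP : P ⊆ ball c r) :
    ∃ Q : Set E, Q.ncard = P.ncard ∧ (P.Finite → Q.Finite) ∧
      Nonempty ((ball c r \ P : Set E) ≃ₜ (Qᶜ : Set E)) := by
  let e := OpenPartialHomeomorph.univBall c r
  have hs : e.source = univ := OpenPartialHomeomorph.univBall_source c r
  have ht : e.target = ball c r := OpenPartialHomeomorph.univBall_target c hr
  have he : Topology.IsOpenEmbedding e := e.isOpenEmbedding hs
  have hr' : range e = ball c r := by
    rw [← image_univ, ← hs, e.image_source_eq_target, ht]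
  refine ⟨e ⁻¹' P, ncard_preimage_of_injective_subset_range he.injective (hr' ▸ hP),
    fun hf => hf.preimage he.injective.injOn, ⟨?_⟩⟩
  refine ((he.isEmbedding.homeomorphImage _).trans (Homeomorph.setCongr ?_)).symm
  rw [← preimage_compl, image_preimage_eq_inter_range, hr', inter_comm, sdiff_eq]

theorem isPreconnected_ball_diff (hE : 1 < Module.rank ℝ E) (c : E) {r : ℝ} (hr : 0 < r)
    {P : Set E} (hP : P.Finite) : IsPreconnected (ball c r \ P) := by
  -- `P` may leave the ball, so it is first replaced by its part inside.
  obtain ⟨Q, -, hQ, ⟨h⟩⟩ := exists_homeomorph_ball_diff hr (inter_subset_left : ball c r ∩ P ⊆ _)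
  rw [sdiff_self_inter] at h
  have h1 := ((hQ (hP.inter_of_right _)).countable.isConnected_compl_of_one_lt_rank hE).isPreconnected
  have := isPreconnected_iff_preconnectedSpace.1 h1
  rw [isPreconnected_iff_preconnectedSpace]
  exact h.symm.surjective.denseRange.preconnectedSpace h.symm.continuous

theorem closure_ball_diff [Nontrivial E] (c : E) {r : ℝ} (hr : r ≠ 0) {P : Set E}
    (hP : P.Finite) : closure (ball c r \ P) = closedBall c r := by
  rw [← closure_ball c hr]
  refine Subset.antisymm (closure_mono sdiff_subset) ?_
  refine closure_minimal ?_ isClosed_closure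
  rw [sdiff_eq]
  exact (hP.countable.dense_compl ℝ).open_subset_closure_inter isOpen_ball

/-- The set lies between the connected punctured open ball and the closure of that ball. -/
theorem isPreconnected_closedBall_diff_singleton (hE : 1 < Module.rank ℝ E) (c : E) {r : ℝ}
    (hr : 0 < r) (p : E) : IsPreconnected (closedBall c r \ {p}) := by
  have : Nontrivial E := (rank_pos_iff_nontrivial (R := ℝ)).1 (zero_lt_one.trans hE)
  refine (isPreconnected_ball_diff hE c hr (finite_singleton p)).subset_closure
    (sdiff_subset_sdiff_left ball_subset_closedBall) ?_
  rw [closure_ball_diff c hr.ne' (finite_singleton p)]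
  exact sdiff_subset

variable [FiniteDimensional ℝ E]

/-- There is one class for each puncture, and `none` stands for the end at infinity. -/
theorem exists_isEndPartition_compl [Nontrivial E] {P : Set E} (hP : P.Finite) :
    ∃ W : Option P → Set (Pᶜ : Set E), IsEndPartition W := by
  obtain ⟨U, hU, hUd⟩ := hP.t2_separation
  obtain ⟨R, hR⟩ := (isBounded_iff_subset_ball (0 : E)).1 hP.isBounded
  let V : Option P → Set E := fun o =>
    o.elim (closedBall 0 R)ᶜ (fun p => U p ∩ ball 0 R)
  have hVo : ∀ o, IsOpen (V o) := by
    rintro (_ | p)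
    · exact isClosed_closedBall.isOpen_compl
    · exact (hU p).2.inter isOpen_ball
  refine ⟨fun o => (↑) ⁻¹' V o, fun o => (hVo o).preimage continuous_subtype_val, ?_, ?_, ?_⟩
  · intro o o' hoo
    refine Disjoint.preimage _ ?_
    have hnone : ∀ p : P, Disjoint (V none) (V (some p)) := fun p =>
      disjoint_left.2 fun x hx hx' => hx (ball_subset_closedBall hx'.2)
    rcases o with _ | p <;> rcases o' with _ | p'
    · exact absurd rfl hoo
    · exact hnone p'
    · exact (hnone p).symm
    · refine (hUd p.2 p'.2 ?_).mono inter_subset_left inter_subset_left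
      intro h
      exact hoo (congrArg some (Subtype.ext h))
  · intro o K hK hsub
    have hK' : IsCompact ((↑) '' K : Set E) := hK.image continuous_subtype_val
    have hKP : ((↑) '' K : Set E) ⊆ Pᶜ := by
      rintro _ ⟨y, -, rfl⟩
      exact y.2
    have hVK : V o ∩ Pᶜ ⊆ ((↑) '' K : Set E) := fun x hx => ⟨⟨x, hx.2⟩, hsub hx.1, rfl⟩
    -- `Pᶜ` is dense, so a compact set containing `V o ∩ Pᶜ` contains all of `V o`: for `none` this
    -- makes `E` bounded, for `some p` it puts the puncture `p` into a subset of `Pᶜ`.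
    have hVK' : V o ⊆ ((↑) '' K : Set E) :=
      ((hP.countable.dense_compl ℝ).open_subset_closure_inter (hVo o)).trans
        (closure_minimal hVK hK'.isClosed)
    rcases o with _ | p
    · have := (hK'.isBounded.subset hVK').union (isBounded_closedBall (x := (0 : E)) (r := R))
      rw [show V none ∪ closedBall (0 : E) R = univ from compl_union_self _] at this
      exact NoncompactSpace.noncompact_univ (X := E)
        (isCompact_of_isClosed_isBounded isClosed_univ this)
    · exact hKP (hVK' ⟨(hU p).1, hR p.2⟩) p.2
  · rw [← preimage_iUnion, ← preimage_compl, Subtype.isCompact_iff,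
      Subtype.image_preimage_coe]
    rw [inter_eq_right.2]
    · refine isCompact_of_isClosed_isBounded (isOpen_iUnion hVo).isClosed_compl
        ((isBounded_closedBall (x := (0 : E)) (r := R)).subset ?_)
      rw [compl_subset_comm]
      exact subset_iUnion V none
    · rw [compl_subset_compl]
      exact fun p hp => mem_iUnion.2 ⟨some ⟨p, hp⟩, (hU p).1, hR hp⟩

/-- Outside a given compact set, small punctured balls around the points of `P` and the exterior of
a large ball are connected and leave a compact remainder. Their connectedness needs dimension at
least two. -/
theorem IsEndPartition.card_le_ncard_add_one (hE : 1 < Module.rank ℝ E) {P : Set E}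
    (hP : P.Finite) {J : Type*} {W : J → Set (Pᶜ : Set E)} (hW : IsEndPartition W) :
    Nat.card J ≤ P.ncard + 1 := by
  have := hP.to_subtype
  rw [show P.ncard + 1 = Nat.card (Option P) by rw [Finite.card_option, Nat.card_coe_set_eq]]
  refine hW.card_le (fun K hK => ?_)
  have hK' : IsCompact ((↑) '' K : Set E) := hK.image continuous_subtype_val
  obtain ⟨R, hR0, hR⟩ : ∃ R : ℝ, 0 ≤ R ∧ ((↑) '' K ∪ P : Set E) ⊆ closedBall 0 R := by
    obtain ⟨R, hR⟩ := (isBounded_iff_subset_closedBall (0 : E)).1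
      (hK'.isBounded.union hP.isBounded)
    exact ⟨max R 0, le_max_right _ _, hR.trans (closedBall_subset_closedBall (le_max_left _ _))⟩
  have hball : ∀ p : P, ∃ ε > 0, ball (p : E) ε ⊆ ((↑) '' K ∪ (P \ {(p : E)}) : Set E)ᶜ := by
    intro p
    refine Metric.isOpen_iff.1
      (hK'.isClosed.union (hP.subset sdiff_subset).isClosed).isOpen_compl p ?_
    rintro (⟨y, -, hy⟩ | h)
    · exact y.2 (hy ▸ p.2)
    · exact h.2 rfl
  choose ε hε hεK using hball
  let V : Option P → Set E := fun o => o.elim (closedBall 0 R)ᶜ (fun p => ball p (ε p))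
  have hVo : ∀ o, IsOpen (V o) := by
    rintro (_ | p)
    · exact isClosed_closedBall.isOpen_compl
    · exact isOpen_ball
  have hVP : ∀ o, IsPreconnected (Pᶜ ∩ V o) := by
    rintro (_ | p)
    · rw [inter_eq_right.2]
      · exact isPreconnected_compl_closedBall hE hR0
      · exact compl_subset_compl.2 (subset_union_right.trans hR)
    · rw [inter_comm, ← sdiff_eq]
      exact isPreconnected_ball_diff hE _ (hε p) hP
  refine ⟨fun o => (↑) ⁻¹' V o, (⋃ o, (↑) ⁻¹' V o)ᶜ, ?_, ?_, ?_, Subset.rfl⟩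
  · intro o
    rw [← Topology.IsInducing.subtypeVal.isPreconnected_image, Subtype.image_preimage_coe]
    exact hVP o
  · rintro (_ | p)
    · exact disjoint_left.2 fun x hx hxK => hx (hR (Or.inl ⟨x, hxK, rfl⟩))
    · exact disjoint_left.2 fun x hx hxK => hεK p hx (Or.inl ⟨x, hxK, rfl⟩)
  · rw [← preimage_iUnion, ← preimage_compl, Subtype.isCompact_iff,
      Subtype.image_preimage_coe, inter_eq_right.2]
    · refine isCompact_of_isClosed_isBounded (isOpen_iUnion hVo).isClosed_compl
        ((isBounded_closedBall (x := (0 : E)) (r := R)).subset ?_)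
      rw [compl_subset_comm]
      exact subset_iUnion V none
    · rw [compl_subset_compl]
      exact fun p hp => mem_iUnion.2 ⟨some ⟨p, hp⟩, mem_ball_self (hε _)⟩

/-- The number of punctures is a homeomorphism invariant. -/
theorem ncard_eq_of_homeomorph_compl (hE : 1 < Module.rank ℝ E) {P Q : Set E} (hP : P.Finite)
    (hQ : Q.Finite) (h : Nonempty ((Pᶜ : Set E) ≃ₜ (Qᶜ : Set E))) : P.ncard = Q.ncard := by
  have : Nontrivial E := (rank_pos_iff_nontrivial (R := ℝ)).1 (zero_lt_one.trans hE)
  obtain ⟨h⟩ := h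
  have key : ∀ {A B : Set E}, A.Finite → B.Finite → ((Aᶜ : Set E) ≃ₜ (Bᶜ : Set E)) →
      A.ncard ≤ B.ncard := by
    intro A B hA hB e
    obtain ⟨W, hW⟩ := exists_isEndPartition_compl hA
    have := (hW.image e).card_le_ncard_add_one hE hB
    have := hA.to_subtype
    rw [Finite.card_option, Nat.card_coe_set_eq] at *
    omega
  exact le_antisymm (key hP hQ h) (key hQ hP h.symm)

end NormedSpace

/-! ### Diagonal cubes and the cut points of a chain -/

section Cubes

variable {ι : Type*}

/-- The closed cube `[a, b]^ι`. -/
def diagCube (ι : Type*) (a b : ℝ) : Set (ι → ℝ) := {x | ∀ i, x i ∈ Icc a b}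

/-- The open cube `(a, b)^ι`. -/
def openDiagCube (ι : Type*) (a b : ℝ) : Set (ι → ℝ) := {x | ∀ i, x i ∈ Ioo a b}

/-- The chain of closed cubes along the diagonal with corners `t a, …, t b`. -/
def cubeChain (ι : Type*) (t : ℕ → ℝ) (a b : ℕ) : Set (ι → ℝ) :=
  ⋃ m ∈ Ico a b, diagCube ι (t m) (t (m + 1))

theorem isClosed_diagCube (a b : ℝ) : IsClosed (diagCube ι a b) := by
  simp only [diagCube, ofPred_forall]
  exact isClosed_iInter fun i => isClosed_Icc.preimage (continuous_apply i)

theorem isClosed_cubeChain (t : ℕ → ℝ) (a b : ℕ) : IsClosed (cubeChain ι t a b) :=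
  (finite_Ico a b).isClosed_biUnion fun _ _ => isClosed_diagCube _ _

theorem convex_diagCube (a b : ℝ) : Convex ℝ (diagCube ι a b) := by
  have : diagCube ι a b = univ.pi fun _ => Icc a b := by
    ext
    simp only [diagCube, mem_univ_pi, mem_ofPred_eq]
  rw [this]
  exact convex_pi fun _ _ => convex_Icc a b

theorem const_mem_diagCube {a b c : ℝ} (h : c ∈ Icc a b) : (fun _ => c) ∈ diagCube ι a b :=
  fun _ => h

theorem isPreconnected_cubeChain {t : ℕ → ℝ} (ht : Monotone t) (a b : ℕ) :
    IsPreconnected (cubeChain ι t a b) := by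
  refine IsPreconnected.biUnion_of_chain ordConnected_Ico
    (fun m _ => (convex_diagCube _ _).isPreconnected) (fun m _ _ => ⟨fun _ => t (m + 1), ?_, ?_⟩)
  · exact const_mem_diagCube ⟨ht (Nat.le_succ _), le_rfl⟩
  · exact const_mem_diagCube ⟨le_rfl, ht (Nat.le_succ _)⟩

theorem openDiagCube_subset (a b : ℝ) : openDiagCube ι a b ⊆ diagCube ι a b :=
  fun _ hx i => Ioo_subset_Icc_self (hx i)

variable [Fintype ι]

theorem diagCube_eq_closedBall {a b : ℝ} (h : a < b) :
    diagCube ι a b = closedBall (fun _ => (a + b) / 2) ((b - a) / 2) := by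
  ext x
  simp only [diagCube, mem_ofPred_eq, mem_closedBall, dist_pi_le_iff (by linarith : 0 ≤ (b - a) / 2),
    Real.Icc_eq_closedBall]

theorem openDiagCube_eq_ball {a b : ℝ} (h : a < b) :
    openDiagCube ι a b = ball (fun _ => (a + b) / 2) ((b - a) / 2) := by
  ext x
  simp only [openDiagCube, mem_ofPred_eq, mem_ball, dist_pi_lt_iff (by linarith : 0 < (b - a) / 2),
    Real.Ioo_eq_ball]

theorem isOpen_openDiagCube {a b : ℝ} (h : a < b) : IsOpen (openDiagCube ι a b) := by
  rw [openDiagCube_eq_ball h]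
  exact isOpen_ball

theorem interior_diagCube {a b : ℝ} (h : a < b) :
    interior (diagCube ι a b) = openDiagCube ι a b := by
  rw [openDiagCube_eq_ball h, diagCube_eq_closedBall h]
  exact interior_closedBall _ (by linarith)

variable [Nontrivial ι]

theorem one_lt_rank_pi : 1 < Module.rank ℝ (ι → ℝ) := by
  rw [rank_fun']
  exact_mod_cast Fintype.one_lt_card

theorem closure_openDiagCube_diff {a b : ℝ} (h : a < b) {P : Set (ι → ℝ)} (hP : P.Finite) :
    closure (openDiagCube ι a b \ P) = diagCube ι a b := by
  rw [openDiagCube_eq_ball h, diagCube_eq_closedBall h]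
  exact closure_ball_diff _ (by linarith) hP

theorem isPreconnected_openDiagCube_diff {a b : ℝ} (h : a < b) {P : Set (ι → ℝ)} (hP : P.Finite) :
    IsPreconnected (openDiagCube ι a b \ P) := by
  rw [openDiagCube_eq_ball h]
  exact isPreconnected_ball_diff one_lt_rank_pi _ (by linarith) hP

theorem isPreconnected_diagCube_diff_singleton {a b : ℝ} (h : a < b) (p : ι → ℝ) :
    IsPreconnected (diagCube ι a b \ {p}) := by
  rw [diagCube_eq_closedBall h]
  exact isPreconnected_closedBall_diff_singleton one_lt_rank_pi _ (by linarith) p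

theorem exists_punctures {a b : ℝ} (h : a < b) (k : ℕ) :
    ∃ P : Set (ι → ℝ), P ⊆ openDiagCube ι a b ∧ P.Finite ∧ P.ncard = k := by
  have hne : (openDiagCube ι a b).Nonempty :=
    ⟨fun _ => (a + b) / 2, fun _ => ⟨by linarith, by linarith⟩⟩
  have hinf : (openDiagCube ι a b).Infinite :=
    infinite_of_mem_nhds hne.some ((isOpen_openDiagCube h).mem_nhds hne.some_mem)
  obtain ⟨s, hs, hk⟩ := hinf.exists_subset_card_eq k
  exact ⟨s, hs, s.finite_toSet, by rw [ncard_coe_finset, hk]⟩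

/-- Deleting any other point leaves every cube connected and every shared corner in place. At a
shared corner, earlier cubes have all coordinates at most `t m` and later ones at least `t m`, so
deleting it separates the two sides. -/
theorem cutPoints_cubeChain {t : ℕ → ℝ} (ht : StrictMono t) (a b : ℕ) :
    cutPoints (cubeChain ι t a b) = (fun m _ => t m) '' Ioo a b := by
  obtain ⟨i0⟩ : Nonempty ι := inferInstance
  refine Subset.antisymm ?_ ?_
  · rintro p ⟨-, hp⟩
    by_contra hcon
    refine hp ?_
    simp only [cubeChain, iUnion_sdiff]
    refine IsPreconnected.biUnion_of_chain ordConnected_Ico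
      (fun m _ => isPreconnected_diagCube_diff_singleton (ht (Nat.lt_succ_self m)) p) ?_
    intro m hm hm'
    have hne : (fun _ : ι => t (m + 1)) ≠ p := fun h =>
      hcon ⟨m + 1, ⟨Nat.lt_succ_of_le hm.1, hm'.2⟩, h⟩
    exact ⟨fun _ => t (m + 1),
      ⟨const_mem_diagCube ⟨(ht (Nat.lt_succ_self m)).le, le_rfl⟩, hne⟩,
      ⟨const_mem_diagCube ⟨le_rfl, (ht (Nat.lt_succ_self _)).le⟩, hne⟩⟩
  · rintro _ ⟨m, ⟨ham, hmb⟩, rfl⟩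
    refine ⟨mem_biUnion (show m ∈ Ico a b from ⟨ham.le, hmb⟩)
      (const_mem_diagCube ⟨le_rfl, (ht (Nat.lt_succ_self _)).le⟩), fun hpre => ?_⟩
    have hside : ∀ x ∈ cubeChain ι t a b, (∀ i, x i ≤ t m) ∨ ∀ i, t m ≤ x i := by
      intro x hx
      obtain ⟨j, -, hxj⟩ := mem_iUnion₂.1 hx
      rcases lt_or_ge j m with hj | hj
      · exact Or.inl fun i => (hxj i).2.trans (ht.monotone hj)
      · exact Or.inr fun i => (ht.monotone hj).trans (hxj i).1
    have hu : IsOpen {x : ι → ℝ | ∃ i, x i < t m} := by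
      simp only [ofPred_exists]
      exact isOpen_iUnion fun i => isOpen_Iio.preimage (continuous_apply i)
    have hv : IsOpen {x : ι → ℝ | ∃ i, t m < x i} := by
      simp only [ofPred_exists]
      exact isOpen_iUnion fun i => isOpen_Ioi.preimage (continuous_apply i)
    have hinter := hpre _ _ hu hv ?_ ?_ ?_
    · obtain ⟨x, hx, ⟨i, hi⟩, ⟨j, hj⟩⟩ := hinter
      rcases hside x hx.1 with h | h
      · exact (h j).not_gt hj
      · exact (h i).not_gt hi
    · rintro x ⟨-, hx⟩
      obtain ⟨i, hi⟩ := Function.ne_iff.1 hx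
      rcases lt_or_gt_of_ne hi with h | h
      · exact Or.inl ⟨i, h⟩
      · exact Or.inr ⟨i, h⟩
    · refine ⟨fun _ => t a, ⟨mem_biUnion (show a ∈ Ico a b from ⟨le_rfl, ham.trans hmb⟩)
        (const_mem_diagCube ⟨le_rfl, (ht (Nat.lt_succ_self _)).le⟩), fun h => ?_⟩, i0, ht ham⟩
      exact (ht ham).ne (congrFun h i0)
    · have hb : b - 1 + 1 = b := by omega
      refine ⟨fun _ => t b, ⟨mem_biUnion (show b - 1 ∈ Ico a b from ⟨by omega, by omega⟩)
        (const_mem_diagCube ⟨ht.monotone (Nat.sub_le _ _), hb.symm ▸ le_rfl⟩), fun h => ?_⟩,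
        i0, ht hmb⟩
      exact (ht hmb).ne' (congrFun h i0)

theorem ncard_cutPoints_cubeChain {t : ℕ → ℝ} (ht : StrictMono t) (a b : ℕ) :
    (cutPoints (cubeChain ι t a b)).ncard = b - a - 1 := by
  obtain ⟨i0⟩ : Nonempty ι := inferInstance
  rw [cutPoints_cubeChain ht, ncard_image_of_injective _
    (fun m m' h => ht.injective (congrFun h i0)), ← Finset.coe_Ioo, ncard_coe_finset, Nat.card_Ioo]

theorem ncard_cutPoints_diagCube {a b : ℝ} (h : a < b) :
    (cutPoints (diagCube ι a b)).ncard = 0 := by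
  have : cutPoints (diagCube ι a b) = ∅ := by
    refine eq_empty_of_forall_notMem fun p hp => ?_
    exact hp.2 (isPreconnected_diagCube_diff_singleton h p)
  rw [this, ncard_empty]

end Cubes

/-! ### Coding a set of naturals by chains -/

section Families

variable {ι : Type*}

/-- The index of the first cube of the `k`-th chain; the chains are separated by gaps. -/
def chainStart (k : ℕ) : ℕ := (k + 1) ^ 2

/-- The `k`-th chain, consisting of `k + 2` cubes. -/
def kthChain (ι : Type*) (t : ℕ → ℝ) (k : ℕ) : Set (ι → ℝ) :=
  cubeChain ι t (chainStart k) (chainStart k + (k + 2))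

/-- The union of the chains with index in `S` and of one additional unit cube. -/
def chainUnion (ι : Type*) (t : ℕ → ℝ) (q : ℝ) (S : Set ℕ) : Set (ι → ℝ) :=
  diagCube ι q (q + 1) ∪ ⋃ k ∈ S, kthChain ι t k

/-- The union of the punctured open cubes in the chains with index in `S` and of one additional
open unit cube. -/
def puncturedUnion (t : ℕ → ℝ) (q : ℝ) (P : ℕ → ℕ → Set (ι → ℝ)) (S : Set ℕ) : Set (ι → ℝ) :=
  openDiagCube ι q (q + 1) ∪ ⋃ k ∈ S, ⋃ m ∈ Ico (chainStart k) (chainStart k + (k + 2)),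
    (openDiagCube ι (t m) (t (m + 1)) \ P k m)

theorem chainStart_pos (k : ℕ) : 0 < chainStart k := by
  unfold chainStart
  positivity

theorem le_chainStart (k : ℕ) : k ≤ chainStart k := by
  unfold chainStart
  nlinarith

/-- Consecutive squares differ by `2 * j + 3 ≥ (j + 2) + 1`, so at least one cube is skipped between
chains. -/
theorem chainStart_gap {j k : ℕ} (h : j < k) : chainStart j + (j + 2) + 1 ≤ chainStart k := by
  have : (j + 2) ^ 2 ≤ (k + 1) ^ 2 := Nat.pow_le_pow_left (by omega) 2
  unfold chainStart
  nlinarith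

theorem eq_of_mem_chain {j k m : ℕ} (hj : m ∈ Ico (chainStart j) (chainStart j + (j + 2)))
    (hk : m ∈ Ico (chainStart k) (chainStart k + (k + 2))) : j = k := by
  rcases lt_trichotomy j k with h | h | h
  · have := chainStart_gap h
    exact absurd hj.2 (by have := hk.1; omega)
  · exact h
  · have := chainStart_gap h
    exact absurd hk.2 (by have := hj.1; omega)

theorem mem_cubeChain_bounds {t : ℕ → ℝ} (ht : Monotone t) {a b : ℕ} {x : ι → ℝ}
    (hx : x ∈ cubeChain ι t a b) (i : ι) : x i ∈ Icc (t a) (t b) := by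
  obtain ⟨m, hm, hxm⟩ := mem_iUnion₂.1 hx
  exact ⟨(ht hm.1).trans (hxm i).1, (hxm i).2.trans (ht hm.2)⟩

theorem corner_mem_kthChain {t : ℕ → ℝ} (ht : Monotone t) (k : ℕ) :
    (fun _ => t (chainStart k)) ∈ kthChain ι t k :=
  mem_biUnion (show chainStart k ∈ Ico _ _ from ⟨le_rfl, by omega⟩)
    (const_mem_diagCube ⟨le_rfl, ht (Nat.le_succ _)⟩)

theorem kthChain_subset_chainUnion (t : ℕ → ℝ) (q : ℝ) {S : Set ℕ} {k : ℕ} (hk : k ∈ S) :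
    kthChain ι t k ⊆ chainUnion ι t q S :=
  (subset_biUnion_of_mem (u := fun k => kthChain ι t k) hk).trans subset_union_right

theorem connectedComponentIn_chainUnion_of_mem_kthChain [Nonempty ι] {t : ℕ → ℝ}
    (ht : StrictMono t) {q : ℝ} (hq : q + 1 ≤ t 0 ∨ ∀ m, t m ≤ q) {S : Set ℕ} {k : ℕ}
    (hk : k ∈ S) {x : ι → ℝ} (hx : x ∈ kthChain ι t k) :
    connectedComponentIn (chainUnion ι t q S) x = kthChain ι t k := by
  obtain ⟨i⟩ := ‹Nonempty ι›
  have hpos := chainStart_pos k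
  -- One coordinate suffices: the corners just before and just after the chain bound a window that
  -- no other piece enters. Since `chainStart k` is positive, the earlier corner exists.
  have hlow : t (chainStart k - 1) < t (chainStart k) := ht (by omega)
  have hhigh : t (chainStart k + (k + 2)) < t (chainStart k + (k + 2) + 1) := ht (by omega)
  have key : ∀ y ∈ chainUnion ι t q S, y ∉ kthChain ι t k →
      y i ∉ Ioo (t (chainStart k - 1)) (t (chainStart k + (k + 2) + 1)) := by
    rintro y (hy | hy) hyk hyi
    · rcases hq with hq | hq
      · have := (hy i).2
        have := ht.monotone (Nat.zero_le (chainStart k - 1))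
        linarith [hyi.1]
      · linarith [hyi.2, (hy i).1, hq (chainStart k + (k + 2) + 1)]
    · obtain ⟨j, -, hyj⟩ := mem_iUnion₂.1 hy
      have hb := mem_cubeChain_bounds ht.monotone hyj i
      rcases lt_trichotomy j k with h | h | h
      · have := chainStart_gap h
        have := ht.monotone (show chainStart j + (j + 2) ≤ chainStart k - 1 by omega)
        linarith [hyi.1, hb.2]
      · exact hyk (h ▸ hyj)
      · have := ht.monotone (chainStart_gap h)
        linarith [hyi.2, hb.1]
  have hin : ∀ y ∈ kthChain ι t k, y i ∈ Icc (t (chainStart k)) (t (chainStart k + (k + 2))) :=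
    fun y hy => mem_cubeChain_bounds ht.monotone hy i
  refine connectedComponentIn_eq_of_separated
    (u := (fun y : ι → ℝ => y i) ⁻¹' Ioo (t (chainStart k - 1)) (t (chainStart k + (k + 2) + 1)))
    (v := (fun y : ι → ℝ => y i) ⁻¹' (Icc (t (chainStart k)) (t (chainStart k + (k + 2))))ᶜ)
    (isPreconnected_cubeChain ht.monotone _ _) (isOpen_Ioo.preimage (continuous_apply i))
    (isClosed_Icc.isOpen_compl.preimage (continuous_apply i)) ?_ ?_ ?_ hx
  · intro y hy
    by_cases hyk : y ∈ kthChain ι t k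
    · exact Or.inl ⟨hlow.trans_le (hin y hyk).1, (hin y hyk).2.trans_lt hhigh⟩
    · refine Or.inr fun h => key y hy hyk ⟨hlow.trans_le h.1, h.2.trans_lt hhigh⟩
  · intro y hy hyu hyv
    by_cases hyk : y ∈ kthChain ι t k
    · exact hyv (hin y hyk)
    · exact key y hy hyk hyu
  · refine Subset.antisymm (fun y hy => ?_) (fun y hy => ⟨?_, ?_⟩)
    · by_contra hyk
      exact key y hy.1 hyk hy.2
    · exact kthChain_subset_chainUnion t q hk hy
    · exact ⟨hlow.trans_le (hin y hy).1, (hin y hy).2.trans_lt hhigh⟩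

theorem disjoint_kthChain_diagCube [Nonempty ι] {t : ℕ → ℝ} (ht : StrictMono t) {q : ℝ}
    (hq : q + 1 ≤ t 0 ∨ ∀ m, t m ≤ q) (k : ℕ) :
    Disjoint (kthChain ι t k) (diagCube ι q (q + 1)) := by
  obtain ⟨i⟩ := ‹Nonempty ι›
  refine disjoint_left.2 fun y hy hy' => ?_
  have hb := mem_cubeChain_bounds ht.monotone hy i
  rcases hq with hq | hq
  · have := ht (chainStart_pos k)
    linarith [hb.1, (hy' i).2]
  · have := ht (Nat.lt_succ_self (chainStart k + (k + 2)))
    have := hq (chainStart k + (k + 2)).succ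
    linarith [hb.2, (hy' i).1]

theorem mem_iff_exists_ncard_cutPoints [Fintype ι] [Nontrivial ι] {t : ℕ → ℝ} (ht : StrictMono t)
    {q : ℝ} (hq : q + 1 ≤ t 0 ∨ ∀ m, t m ≤ q) (S : Set ℕ) (k : ℕ) :
    k ∈ S ↔ ∃ x ∈ chainUnion ι t q S,
      (cutPoints (connectedComponentIn (chainUnion ι t q S) x)).ncard = k + 1 := by
  have hcut : ∀ j, (cutPoints (kthChain ι t j)).ncard = j + 1 := by
    intro j
    rw [kthChain, ncard_cutPoints_cubeChain ht]
    omega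
  have hcomp := fun {j : ℕ} (hj : j ∈ S) {x : ι → ℝ} (hx : x ∈ kthChain ι t j) =>
    connectedComponentIn_chainUnion_of_mem_kthChain ht hq hj hx
  constructor
  · intro hk
    have hmem := corner_mem_kthChain (ι := ι) ht.monotone k
    refine ⟨_, kthChain_subset_chainUnion t q hk hmem, ?_⟩
    rw [hcomp hk hmem, hcut]
  · rintro ⟨x, hx, hxk⟩
    rcases hx with hx | hx
    -- Chains may accumulate at the extra cube, so no open window need isolate it; it is a component
    -- because all other pieces are.
    · rw [connectedComponentIn_eq_of_forall_diff (A := chainUnion ι t q S) (convex_diagCube q (q + 1)).isPreconnected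
        subset_union_left ?_ hx, ncard_cutPoints_diagCube (by linarith)] at hxk
      · omega
      · rintro y (hy | hy) hyQ
        · exact absurd hy hyQ
        · obtain ⟨j, hj, hyj⟩ := mem_iUnion₂.1 hy
          rw [hcomp hj hyj]
          exact disjoint_kthChain_diagCube ht hq j
    · obtain ⟨j, hj, hxj⟩ := mem_iUnion₂.1 hx
      rw [hcomp hj hxj, hcut] at hxk
      rwa [← Nat.succ_injective hxk]

theorem eq_of_homeomorph_chainUnion [Fintype ι] [Nontrivial ι] {t : ℕ → ℝ} (ht : StrictMono t)
    {q : ℝ} (hq : q + 1 ≤ t 0 ∨ ∀ m, t m ≤ q) {S T : Set ℕ}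
    (h : Nonempty (chainUnion ι t q S ≃ₜ chainUnion ι t q T)) : S = T :=
  eq_of_homeomorph_of_component_label (P := fun k C => (cutPoints C).ncard = k + 1)
    (fun _ _ _ ⟨e⟩ hC => e.ncard_cutPoints_eq ▸ hC)
    (mem_iff_exists_ncard_cutPoints ht hq S) (mem_iff_exists_ncard_cutPoints ht hq T) h

theorem mem_puncturedUnion {t : ℕ → ℝ} {q : ℝ} {P : ℕ → ℕ → Set (ι → ℝ)} {S : Set ℕ}
    {x : ι → ℝ} : x ∈ puncturedUnion t q P S ↔
    x ∈ openDiagCube ι q (q + 1) ∨ ∃ k ∈ S, ∃ m ∈ Ico (chainStart k) (chainStart k + (k + 2)),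
      x ∈ openDiagCube ι (t m) (t (m + 1)) \ P k m := by
  simp only [puncturedUnion, mem_union, mem_iUnion, exists_prop]

/-! ### Components and closures of the open sets -/

section Punctured

variable [Fintype ι] {t : ℕ → ℝ} {q : ℝ} {P : ℕ → ℕ → Set (ι → ℝ)}

theorem isOpen_puncturedUnion (ht : StrictMono t) (hP : ∀ k m, (P k m).Finite) (S : Set ℕ) :
    IsOpen (puncturedUnion t q P S) := by
  refine (isOpen_openDiagCube (by linarith)).union ?_
  refine isOpen_biUnion fun k _ => isOpen_biUnion fun m _ => ?_
  exact (isOpen_openDiagCube (ht (Nat.lt_succ_self m))).sdiff (hP k m).isClosed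

theorem exists_homeomorph_openDiagCube_diff {a b : ℝ} (h : a < b) {A : Set (ι → ℝ)}
    (hA : A ⊆ openDiagCube ι a b) (hf : A.Finite) :
    ∃ B : Set (ι → ℝ), B.ncard = A.ncard ∧ B.Finite ∧
      Nonempty ((openDiagCube ι a b \ A : Set (ι → ℝ)) ≃ₜ (Bᶜ : Set (ι → ℝ))) := by
  rw [openDiagCube_eq_ball h] at hA ⊢
  obtain ⟨B, h1, h2, h3⟩ := exists_homeomorph_ball_diff (by linarith : 0 < (b - a) / 2) hA
  exact ⟨B, h1, h2 hf, h3⟩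

variable [Nontrivial ι]

theorem closure_puncturedUnion (ht : StrictMono t) (hP : ∀ k m, (P k m).Finite) {S : Set ℕ}
    (hS : IsClosed (chainUnion ι t q S)) :
    closure (puncturedUnion t q P S) = chainUnion ι t q S := by
  refine Subset.antisymm (closure_minimal ?_ hS) ?_
  · intro x hx
    rcases mem_puncturedUnion.1 hx with hx | ⟨k, hk, m, hm, hx⟩
    · exact Or.inl (openDiagCube_subset _ _ hx)
    · exact kthChain_subset_chainUnion t q hk
        (mem_biUnion hm (openDiagCube_subset _ _ hx.1))
  · rintro x (hx | hx)
    · rw [← closure_openDiagCube_diff (by linarith) finite_empty, sdiff_empty] at hx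
      exact closure_mono subset_union_left hx
    · obtain ⟨k, hk, hx⟩ := mem_iUnion₂.1 hx
      obtain ⟨m, hm, hx⟩ := mem_iUnion₂.1 hx
      rw [← closure_openDiagCube_diff (ht (Nat.lt_succ_self m)) (hP k m)] at hx
      exact closure_mono (fun y hy => mem_puncturedUnion.2 (Or.inr ⟨k, hk, m, hm, hy⟩)) hx

theorem connectedComponentIn_puncturedUnion_of_mem_openDiagCube (ht : StrictMono t)
    (hq : q + 1 ≤ t 0 ∨ ∀ m, t m ≤ q) {S : Set ℕ} {x : ι → ℝ}
    (hx : x ∈ openDiagCube ι q (q + 1)) :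
    connectedComponentIn (puncturedUnion t q P S) x = openDiagCube ι q (q + 1) := by
  obtain ⟨i⟩ : Nonempty ι := inferInstance
  have hpre : IsPreconnected (openDiagCube ι q (q + 1)) := by
    simpa using isPreconnected_openDiagCube_diff (ι := ι) (by linarith : q < q + 1) finite_empty
  have key : ∀ y ∈ puncturedUnion t q P S, y ∉ openDiagCube ι q (q + 1) →
      y i ∉ Icc q (q + 1) := by
    intro y hy hyQ hyi
    rcases mem_puncturedUnion.1 hy with hy | ⟨k, hk, m, hm, hy⟩
    · exact hyQ hy
    · have hyi' := hy.1 i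
      rcases hq with hq | hq
      · linarith [ht.monotone (Nat.zero_le m), hyi'.1, hyi.2]
      · linarith [hq (m + 1), hyi'.2, hyi.1]
  refine connectedComponentIn_eq_of_separated (u := (fun y : ι → ℝ => y i) ⁻¹' Ioo q (q + 1))
    (v := (fun y : ι → ℝ => y i) ⁻¹' (Icc q (q + 1))ᶜ) hpre
    (isOpen_Ioo.preimage (continuous_apply i))
    (isClosed_Icc.isOpen_compl.preimage (continuous_apply i)) ?_
    (fun y _ hyu hyv => hyv (Ioo_subset_Icc_self hyu)) ?_ hx
  · intro y hy
    by_cases hyQ : y ∈ openDiagCube ι q (q + 1)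
    · exact Or.inl (hyQ i)
    · exact Or.inr (key y hy hyQ)
  · refine Subset.antisymm (fun y hy => ?_) (fun y hy => ⟨Or.inl hy, hy i⟩)
    by_contra hyQ
    exact key y hy.1 hyQ (Ioo_subset_Icc_self hy.2)

theorem connectedComponentIn_puncturedUnion_of_mem_diff (ht : StrictMono t)
    (hq : q + 1 ≤ t 0 ∨ ∀ m, t m ≤ q) (hP : ∀ k m, (P k m).Finite) {S : Set ℕ} {k m : ℕ}
    (hk : k ∈ S) (hm : m ∈ Ico (chainStart k) (chainStart k + (k + 2))) {x : ι → ℝ}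
    (hx : x ∈ openDiagCube ι (t m) (t (m + 1)) \ P k m) :
    connectedComponentIn (puncturedUnion t q P S) x =
      openDiagCube ι (t m) (t (m + 1)) \ P k m := by
  obtain ⟨i⟩ : Nonempty ι := inferInstance
  have key : ∀ y ∈ puncturedUnion t q P S, y ∉ openDiagCube ι (t m) (t (m + 1)) \ P k m →
      y i ∉ Icc (t m) (t (m + 1)) := by
    intro y hy hym hyi
    rcases mem_puncturedUnion.1 hy with hy | ⟨k', hk', m', hm', hy⟩
    · have hyi' := hy i
      rcases hq with hq | hq
      · linarith [ht.monotone (Nat.zero_le m), hyi'.2, hyi.1]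
      · linarith [hq (m + 1), hyi'.1, hyi.2]
    · have hyi' := hy.1 i
      rcases lt_trichotomy m m' with h | h | h
      · have := ht.monotone (show m + 1 ≤ m' from h)
        linarith [hyi'.1, hyi.2]
      · subst h
        exact hym (eq_of_mem_chain hm hm' ▸ hy)
      · have := ht.monotone (show m' + 1 ≤ m from h)
        linarith [hyi'.2, hyi.1]
  refine connectedComponentIn_eq_of_separated
    (u := (fun y : ι → ℝ => y i) ⁻¹' Ioo (t m) (t (m + 1)))
    (v := (fun y : ι → ℝ => y i) ⁻¹' (Icc (t m) (t (m + 1)))ᶜ)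
    (isPreconnected_openDiagCube_diff (ht (Nat.lt_succ_self m)) (hP k m))
    (isOpen_Ioo.preimage (continuous_apply i))
    (isClosed_Icc.isOpen_compl.preimage (continuous_apply i)) ?_
    (fun y _ hyu hyv => hyv (Ioo_subset_Icc_self hyu)) ?_ hx
  · intro y hy
    by_cases hyQ : y ∈ openDiagCube ι (t m) (t (m + 1)) \ P k m
    · exact Or.inl (hyQ.1 i)
    · exact Or.inr (key y hy hyQ)
  · refine Subset.antisymm (fun y hy => ?_)
      (fun y hy => ⟨mem_puncturedUnion.2 (Or.inr ⟨k, hk, m, hm, hy⟩), hy.1 i⟩)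
    by_contra hyQ
    exact key y hy.1 hyQ (Ioo_subset_Icc_self hy.2)

theorem mem_iff_exists_homeomorph_compl (ht : StrictMono t) (hq : q + 1 ≤ t 0 ∨ ∀ m, t m ≤ q)
    (hP : ∀ k m, (P k m).Finite) (hPsub : ∀ k m, P k m ⊆ openDiagCube ι (t m) (t (m + 1)))
    (hPcard : ∀ k m, (P k m).ncard = k + 1) (S : Set ℕ) (k : ℕ) :
    k ∈ S ↔ ∃ x ∈ puncturedUnion t q P S, ∃ B : Set (ι → ℝ), B.ncard = k + 1 ∧ B.Finite ∧
      Nonempty (connectedComponentIn (puncturedUnion t q P S) x ≃ₜ (Bᶜ : Set (ι → ℝ))) := by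
  constructor
  · intro hk
    have hm : chainStart k ∈ Ico (chainStart k) (chainStart k + (k + 2)) := ⟨le_rfl, by omega⟩
    have hlt := ht (Nat.lt_succ_self (chainStart k))
    obtain ⟨x, hx⟩ : (openDiagCube ι (t (chainStart k)) (t (chainStart k + 1)) \
        P k (chainStart k)).Nonempty := by
      -- The punctured cube is nonempty because its closure contains a corner.
      rw [← closure_nonempty_iff, closure_openDiagCube_diff hlt (hP _ _)]
      exact ⟨_, const_mem_diagCube ⟨le_rfl, hlt.le⟩⟩
    refine ⟨x, mem_puncturedUnion.2 (Or.inr ⟨k, hk, _, hm, hx⟩), ?_⟩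
    rw [connectedComponentIn_puncturedUnion_of_mem_diff ht hq hP hk hm hx, ← hPcard k]
    exact exists_homeomorph_openDiagCube_diff hlt (hPsub _ _) (hP _ _)
  · rintro ⟨x, hx, B, hB, hBf, ⟨e⟩⟩
    rcases mem_puncturedUnion.1 hx with hx | ⟨j, hj, m, hm, hx⟩
    -- The extra cube counts as having `0` punctures, which differs from `k + 1`.
    · rw [connectedComponentIn_puncturedUnion_of_mem_openDiagCube ht hq hx,
        ← sdiff_empty (s := openDiagCube ι q (q + 1))] at e
      obtain ⟨D, hD, hDf, ⟨e'⟩⟩ := exists_homeomorph_openDiagCube_diff (by linarith : q < q + 1)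
        (empty_subset _) (finite_empty (α := ι → ℝ))
      have := ncard_eq_of_homeomorph_compl one_lt_rank_pi hDf hBf ⟨e'.symm.trans e⟩
      rw [hD, hB, ncard_empty] at this
      omega
    · rw [connectedComponentIn_puncturedUnion_of_mem_diff ht hq hP hj hm hx] at e
      obtain ⟨D, hD, hDf, ⟨e'⟩⟩ := exists_homeomorph_openDiagCube_diff
        (ht (Nat.lt_succ_self m)) (hPsub j m) (hP j m)
      have := ncard_eq_of_homeomorph_compl one_lt_rank_pi hDf hBf ⟨e'.symm.trans e⟩
      rw [hD, hB, hPcard] at this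
      rwa [← Nat.succ_injective this]

theorem eq_of_homeomorph_puncturedUnion (ht : StrictMono t) (hq : q + 1 ≤ t 0 ∨ ∀ m, t m ≤ q)
    (hP : ∀ k m, (P k m).Finite) (hPsub : ∀ k m, P k m ⊆ openDiagCube ι (t m) (t (m + 1)))
    (hPcard : ∀ k m, (P k m).ncard = k + 1) {S T : Set ℕ}
    (h : Nonempty (puncturedUnion t q P S ≃ₜ puncturedUnion t q P T)) : S = T :=
  eq_of_homeomorph_of_component_label
    (P := fun k C => ∃ B : Set (ι → ℝ), B.ncard = k + 1 ∧ B.Finite ∧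
      Nonempty (C ≃ₜ (Bᶜ : Set (ι → ℝ))))
    (fun _ _ _ ⟨e⟩ ⟨B, h1, h2, ⟨e'⟩⟩ => ⟨B, h1, h2, ⟨e.symm.trans e'⟩⟩)
    (mem_iff_exists_homeomorph_compl ht hq hP hPsub hPcard S)
    (mem_iff_exists_homeomorph_compl ht hq hP hPsub hPcard T) h

end Punctured

/-- Only finitely many chains reach below `t M`, since `k ≤ chainStart k`; near `x` the union is a
finite union of closed sets. -/
theorem mem_chainUnion_of_mem_closure {t : ℕ → ℝ} (ht : StrictMono t) {q : ℝ} {S : Set ℕ}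
    {x : ι → ℝ} (hx : x ∈ closure (chainUnion ι t q S)) {i : ι} {M : ℕ} (hM : x i < t M) :
    x ∈ chainUnion ι t q S := by
  have hO : IsOpen {y : ι → ℝ | y i < t M} := isOpen_Iio.preimage (continuous_apply i)
  have hx' := hO.inter_closure ⟨hM, hx⟩
  have hcl : IsClosed (diagCube ι q (q + 1) ∪ ⋃ k ∈ S ∩ Iio M, kthChain ι t k) :=
    (isClosed_diagCube _ _).union (((finite_Iio M).inter_of_right S).isClosed_biUnion
      fun _ _ => isClosed_cubeChain _ _ _)
  have hsub : {y : ι → ℝ | y i < t M} ∩ chainUnion ι t q S ⊆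
      diagCube ι q (q + 1) ∪ ⋃ k ∈ S ∩ Iio M, kthChain ι t k := by
    rintro y ⟨hyM, hy | hy⟩
    · exact Or.inl hy
    · obtain ⟨k, hk, hyk⟩ := mem_iUnion₂.1 hy
      have h1 := (mem_cubeChain_bounds ht.monotone hyk i).1.trans_lt hyM
      exact Or.inr (mem_biUnion ⟨hk, (le_chainStart k).trans_lt (ht.lt_iff_lt.1 h1)⟩ hyk)
  exact union_subset_union_right _ (biUnion_subset_biUnion_left inter_subset_left)
    (closure_minimal hsub hcl hx')

end Families

/-! ### Transfer to Euclidean space and the two corner sequences -/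

section Euclidean

variable {n : ℕ}

/-- The identification of `Fin n → ℝ` with Euclidean space. -/
noncomputable def piToEuclidean (n : ℕ) : (Fin n → ℝ) ≃ₜ EuclideanSpace ℝ (Fin n) :=
  (EuclideanSpace.equiv (Fin n) ℝ).symm.toHomeomorph

theorem image_diagCube (a h : ℝ) :
    piToEuclidean n '' diagCube (Fin n) a (a + h) = closedCube (fun _ => a) h := by
  rw [Homeomorph.image_eq_preimage_symm]
  rfl

theorem exists_isDistinctOpenFamily (hn : 2 ≤ n) {t : ℕ → ℝ} (ht : StrictMono t) {q : ℝ}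
    (hq : q + 1 ≤ t 0 ∨ ∀ m, t m ≤ q) (hcl : ∀ S, IsClosed (chainUnion (Fin n) t q S)) :
    ∃ F : Set (Set (EuclideanSpace ℝ (Fin n))), IsDistinctOpenFamily F ∧
      ∀ X ∈ F, ∃ S, closure X = piToEuclidean n '' chainUnion (Fin n) t q S := by
  have : Nontrivial (Fin n) := Fin.nontrivial_iff_two_le.2 hn
  choose P hPsub hP hPcard using fun k m : ℕ =>
    exists_punctures (ι := Fin n) (ht (Nat.lt_succ_self m)) (k + 1)
  let U : Set ℕ → Set (EuclideanSpace ℝ (Fin n)) :=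
    fun S => piToEuclidean n '' puncturedUnion t q P S
  have hUcl : ∀ S, closure (U S) = piToEuclidean n '' chainUnion (Fin n) t q S := fun S => by
    rw [← Homeomorph.image_closure, closure_puncturedUnion ht hP (hcl S)]
  have hU : ∀ S T, Nonempty (U S ≃ₜ U T) → S = T := fun S T ⟨e⟩ =>
    eq_of_homeomorph_puncturedUnion ht hq hP hPsub hPcard
      ⟨((piToEuclidean n).image _).trans (e.trans ((piToEuclidean n).image _).symm)⟩
  have hinj : Function.Injective U := fun S T h => hU S T ⟨Homeomorph.setCongr h⟩
  refine ⟨range U, ⟨?_, ?_, ?_, ?_⟩, ?_⟩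
  · rintro _ ⟨S, rfl⟩
    exact (piToEuclidean n).isOpenMap _ (isOpen_puncturedUnion ht hP S)
  · rw [Cardinal.mk_range_eq U hinj, Cardinal.mk_set, Cardinal.mk_nat,
      Cardinal.two_power_aleph0]
  · rintro _ ⟨S, rfl⟩ _ ⟨T, rfl⟩ hne h
    exact hne (congrArg U (hU S T h))
  · rintro _ ⟨S, rfl⟩ _ ⟨T, rfl⟩ hne ⟨e⟩
    rw [hUcl, hUcl] at e
    exact hne (congrArg U (eq_of_homeomorph_chainUnion ht hq
      ⟨((piToEuclidean n).image _).trans (e.trans ((piToEuclidean n).image _).symm)⟩))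
  · rintro _ ⟨S, rfl⟩
    exact ⟨S, hUcl S⟩

theorem mem_chainUnion {ι : Type*} {t : ℕ → ℝ} {q : ℝ} {S : Set ℕ} {x : ι → ℝ} :
    x ∈ chainUnion ι t q S ↔ x ∈ diagCube ι q (q + 1) ∨
      ∃ k ∈ S, ∃ m ∈ Ico (chainStart k) (chainStart k + (k + 2)),
        x ∈ diagCube ι (t m) (t (m + 1)) := by
  simp only [chainUnion, kthChain, cubeChain, mem_union, mem_iUnion, exists_prop]

theorem disjoint_openDiagCube {ι : Type*} [Nonempty ι] {a b c d : ℝ} (h : b ≤ c) :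
    Disjoint (openDiagCube ι a b) (openDiagCube ι c d) := by
  obtain ⟨i⟩ := ‹Nonempty ι›
  exact disjoint_left.2 fun x hx hx' => by linarith [(hx i).2, (hx' i).1]

theorem isUnionOfNonoverlappingCubes_image_chainUnion (hn : 2 ≤ n) {t : ℕ → ℝ}
    (ht : StrictMono t) {q : ℝ} (hq : q + 1 ≤ t 0 ∨ ∀ m, t m ≤ q) (S : Set ℕ) :
    IsUnionOfNonoverlappingCubes (piToEuclidean n '' chainUnion (Fin n) t q S) := by
  have : Nontrivial (Fin n) := Fin.nontrivial_iff_two_le.2 hn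
  let I : Set ℕ := {m | ∃ k ∈ S, m ∈ Ico (chainStart k) (chainStart k + (k + 2))}
  let C : ℕ → Set (EuclideanSpace ℝ (Fin n)) :=
    fun m => piToEuclidean n '' diagCube (Fin n) (t m) (t (m + 1))
  let D : Set (EuclideanSpace ℝ (Fin n)) := piToEuclidean n '' diagCube (Fin n) q (q + 1)
  have hlt : ∀ m, t m < t (m + 1) := fun m => ht (Nat.lt_succ_self m)
  have hint : ∀ a b : ℝ, a < b → interior (piToEuclidean n '' diagCube (Fin n) a b) =
      piToEuclidean n '' openDiagCube (Fin n) a b := fun a b h => by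
    rw [← Homeomorph.image_interior, interior_diagCube h]
  have hdisj : ∀ a b c d : ℝ, a < b → c < d → b ≤ c →
      Disjoint (interior (piToEuclidean n '' diagCube (Fin n) a b))
        (interior (piToEuclidean n '' diagCube (Fin n) c d)) := fun a b c d hab hcd hbc => by
    rw [hint a b hab, hint c d hcd, disjoint_image_iff (piToEuclidean n).injective]
    exact disjoint_openDiagCube hbc
  have hCD : ∀ m, Disjoint (interior (C m)) (interior D) := fun m => by
    rcases hq with hq | hq
    · exact (hdisj _ _ _ _ (by linarith) (hlt m) (hq.trans (ht.monotone (Nat.zero_le m)))).symm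
    · exact hdisj _ _ _ _ (hlt m) (by linarith) (hq (m + 1))
  have hCC : ∀ m m', m < m' → Disjoint (interior (C m)) (interior (C m')) := fun m m' h =>
    hdisj _ _ _ _ (hlt m) (hlt m') (ht.monotone h)
  refine ⟨insert D (C '' I), ?_, ?_, ?_⟩
  · rintro _ (rfl | ⟨m, -, rfl⟩)
    · exact ⟨_, 1, one_pos, image_diagCube q 1⟩
    · refine ⟨fun _ => t m, t (m + 1) - t m, sub_pos.2 (hlt m), ?_⟩
      rw [← image_diagCube, add_sub_cancel]
  · rintro _ (rfl | ⟨m, -, rfl⟩) _ (rfl | ⟨m', -, rfl⟩) hne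
    · exact absurd rfl hne
    · exact (hCD m').symm
    · exact hCD m
    · rcases lt_trichotomy m m' with h | h | h
      · exact hCC m m' h
      · exact absurd (congrArg C h) hne
      · exact (hCC m' m h).symm
  · rw [sUnion_insert, sUnion_image]
    simp only [chainUnion, kthChain, cubeChain, image_union, image_iUnion, D, C, I]
    congr 1
    ext x
    simp only [mem_iUnion, mem_ofPred_eq, exists_prop]
    constructor
    · rintro ⟨k, hk, m, hm, hx⟩
      exact ⟨m, ⟨k, hk, hm⟩, hx⟩
    · rintro ⟨m, ⟨k, hk, hm⟩, hx⟩
      exact ⟨k, hk, m, hm, hx⟩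

theorem isUnionOfIntegerUnitCubes_image_chainUnion (S : Set ℕ) :
    IsUnionOfIntegerUnitCubes (piToEuclidean n '' chainUnion (Fin n) (fun m => m + 1) (-1) S) := by
  refine ⟨insert (fun _ => -1) ((fun (m : ℕ) _ => (m : ℤ) + 1) ''
    {m | ∃ k ∈ S, m ∈ Ico (chainStart k) (chainStart k + (k + 2))}), ?_⟩
  rw [biUnion_insert, biUnion_image]
  simp only [chainUnion, kthChain, cubeChain, image_union, image_iUnion, Nat.cast_add,
    Nat.cast_one, Int.cast_neg, Int.cast_one, Int.cast_add, Int.cast_natCast, image_diagCube]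
  congr 1
  ext x
  simp only [mem_iUnion, mem_ofPred_eq, exists_prop]
  constructor
  · rintro ⟨k, hk, m, hm, hx⟩
    exact ⟨m, ⟨k, hk, hm⟩, hx⟩
  · rintro ⟨m, ⟨k, hk, hm⟩, hx⟩
    exact ⟨k, hk, m, hm, hx⟩

theorem isClosed_chainUnion_nat [Nonempty (Fin n)] (S : Set ℕ) :
    IsClosed (chainUnion (Fin n) (fun m => m + 1) (-1) S) := by
  obtain ⟨i⟩ := ‹Nonempty (Fin n)›
  refine isClosed_of_closure_subset fun x hx => ?_
  obtain ⟨M, hM⟩ := exists_nat_gt (x i)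
  have ht : StrictMono fun m : ℕ => (m : ℝ) + 1 := fun a b h => by
    have : (a : ℝ) < b := Nat.cast_lt.2 h
    linarith
  exact mem_chainUnion_of_mem_closure ht hx (i := i) (M := M) (by linarith)

/-- A sequence increasing to `0`. -/
noncomputable def negInv (m : ℕ) : ℝ := -(1 / ((m : ℝ) + 1))

theorem strictMono_negInv : StrictMono negInv := fun a b h => by
  have : (a : ℝ) < b := Nat.cast_lt.2 h
  exact neg_lt_neg (one_div_lt_one_div_of_lt (by positivity) (by linarith))

theorem negInv_nonpos (m : ℕ) : negInv m ≤ 0 := by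
  unfold negInv
  exact neg_nonpos.2 (by positivity)

theorem chainUnion_negInv_subset {ι : Type*} (S : Set ℕ) :
    chainUnion ι negInv 0 S ⊆ diagCube ι 0 (0 + 1) ∪ Icc (fun _ => -1) (fun _ => 0) := by
  intro x hx
  rcases mem_chainUnion.1 hx with hx | ⟨k, -, m, -, hx⟩
  · exact Or.inl hx
  · refine Or.inr ⟨fun i => ?_, fun i => (hx i).2.trans (negInv_nonpos _)⟩
    have := strictMono_negInv.monotone (Nat.zero_le m)
    have h0 : negInv 0 = -1 := by simp [negInv]
    linarith [(hx i).1]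

theorem isClosed_chainUnion_negInv {ι : Type*} (S : Set ℕ) :
    IsClosed (chainUnion ι negInv 0 S) := by
  refine isClosed_of_closure_subset fun x hx => ?_
  by_cases h : ∃ i M, x i < negInv M
  · obtain ⟨i, M, hM⟩ := h
    exact mem_chainUnion_of_mem_closure strictMono_negInv hx hM
  -- Now no coordinate of `x` is negative, while the limits of the chains lie in `[-1, 0]^ι`; hence
  -- `x` is in the extra cube or is its corner `0`.
  · push Not at h
    refine Or.inl ?_
    rcases closure_minimal (chainUnion_negInv_subset S)
      ((isClosed_diagCube _ _).union isClosed_Icc) hx with hx | hx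
    · exact hx
    · intro i
      have hi : 0 ≤ x i := by
        by_contra! hneg
        obtain ⟨M, hM⟩ := exists_nat_one_div_lt (neg_pos.2 hneg)
        have := h i M
        unfold negInv at this
        linarith
      exact ⟨hi, (hx.2 i).trans (by norm_num)⟩

theorem isCompact_chainUnion_negInv {ι : Type*} [Fintype ι] (S : Set ℕ) :
    IsCompact (chainUnion ι negInv 0 S) := by
  refine IsCompact.of_isClosed_subset (IsCompact.union ?_ isCompact_Icc)
    (isClosed_chainUnion_negInv S) (chainUnion_negInv_subset S)
  rw [diagCube_eq_closedBall (by norm_num)]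
  exact isCompact_closedBall _ _

end Euclidean

theorem theorem2 (n : ℕ) (hn : 2 ≤ n) :
    (∃ F : Set (Set (EuclideanSpace ℝ (Fin n))), IsDistinctOpenFamily F) ∧
    (∃ F : Set (Set (EuclideanSpace ℝ (Fin n))), IsDistinctOpenFamily F ∧
      ∀ X ∈ F, IsCompact (closure X) ∧ IsUnionOfNonoverlappingCubes (closure X)) ∧
    (∃ F : Set (Set (EuclideanSpace ℝ (Fin n))), IsDistinctOpenFamily F ∧
      ∀ X ∈ F, IsUnionOfIntegerUnitCubes (closure X)) := by
  have : Nonempty (Fin n) := ⟨⟨0, by omega⟩⟩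
  -- The extra cube `[0, 1]ⁿ` lies above all chains and contains their limit point.
  obtain ⟨F, hF, hFc⟩ := exists_isDistinctOpenFamily hn strictMono_negInv
    (Or.inr negInv_nonpos) isClosed_chainUnion_negInv
  -- The corners are `1, 2, …`, and the extra cube `[-1, 0]ⁿ` lies below them.
  obtain ⟨G, hG, hGc⟩ := exists_isDistinctOpenFamily (n := n) (t := fun m => m + 1) (q := -1) hn
    (fun a b h => by simpa using h) (Or.inl (by norm_num)) isClosed_chainUnion_nat
  refine ⟨⟨F, hF⟩, ⟨F, hF, fun X hX => ?_⟩, ⟨G, hG, fun X hX => ?_⟩⟩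
  · obtain ⟨S, hS⟩ := hFc X hX
    rw [hS]
    exact ⟨(isCompact_chainUnion_negInv S).image (piToEuclidean n).continuous,
      isUnionOfNonoverlappingCubes_image_chainUnion hn strictMono_negInv (Or.inr negInv_nonpos) S⟩
  · obtain ⟨S, hS⟩ := hGc X hX
    rw [hS]
    exact isUnionOfIntegerUnitCubes_image_chainUnion S
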